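/- **Theorem 3.3.** Fix $p_0\in(0,1)$, $\lambda_{\mathrm{on}},\lambda_{\mathrm{off}}>0$ and $T>0$. For each $N\ge 1$ consider the dynamic Erdős–Rényi graph on the vertices $1,\dots,N$ (self-loops allowed) over the time interval $[0,T]$, whose $N(N+1)/2$ potential edges $\{i,j\}$, $i\le j$, evolve independently as follows. At time $0$ each edge is present with probability $p_0$ and absent with probability $1-p_0$; afterwards, independently of the initial state, it alternates between being present and being absent, where the on-times are exponentially distributed with rate $\lambda_{\mathrm{on}}$, the off-times are exponentially distributed with rate $\lambda_{\mathrm{off}}$, and all these durations are independent. Let $A_N(t)=(a_{i,j}(t))_{i,j=1}^N$ be the symmetric adjacency matrix at time $t$ (so $a_{i,j}(t)=1$ if the edge $\{i,j\}$ is present at time $t$, and $a_{i,j}(t)=0$ otherwise), and let $\mu_N(t)$ be its principal (largest) eigenvalue. Let $p(t):=\mathbb P(a_{i,j}(t)=1)$ for $t\in[0,T]$, which depends neither on $i,j$ nor on $N$. Then, for all $N\ge1$ and $t\in[0,T]$, $\mu_N(t)$ is integrable and $$\mathbb E[\mu_N(t)] = N\,p(t) + (1-p(t)) + \frac{\overline{\mathcal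 G}_N(t)}{N},$$ for some deterministic functions $\overline{\mathcal G}_N:[0,T]\to\mathbb R$ such that $$\limsup_{N\to\infty}\ \sup_{t\in[0,T]}\bigl|\overline{\mathcal G}_N(t)\bigr|<\infty .$$ -/

import Mathlib

open MeasureTheory ProbabilityTheory Filter
open scoped ENNReal

namespace DynamicER

/-- Labels of the primitive random variables of the model on `N` vertices. The potential edges are
the unordered pairs of vertices, loops included (`Sym2 (Fin N)` has `N (N + 1) / 2` elements).
Each potential edge `e` has an initial state, a sequence of off-times and a sequence of on-times. -/
inductive Source (N : ℕ) : Type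
  | init (e : Sym2 (Fin N)) : Source N
  | off (e : Sym2 (Fin N)) (l : ℕ) : Source N
  | on (e : Sym2 (Fin N)) (l : ℕ) : Source N

/-- The law of each primitive variable: initial states are `1` with probability `p₀` and `0` with
probability `1 - p₀`; off-times are exponential with rate `lamOff`; on-times are exponential with
rate `lamOn`. -/
noncomputable def sourceLaw {N : ℕ} (p₀ lamOn lamOff : ℝ) : Source N → Measure ℝ
  | .init _ => ENNReal.ofReal p₀ • Measure.dirac 1 + ENNReal.ofReal (1 - p₀) • Measure.dirac 0
  | .off _ _ => expMeasure lamOff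
  | .on _ _ => expMeasure lamOn

/-- `X` is a family of primitive random variables of the model on `N` vertices: jointly
independent random variables with the prescribed laws. -/
structure IsDriving {N : ℕ} {Ω : Type*} [MeasurableSpace Ω] (p₀ lamOn lamOff : ℝ)
    (P : Measure Ω) (X : Source N → Ω → ℝ) : Prop where
  measurable : ∀ s, Measurable (X s)
  hasLaw : ∀ s, HasLaw (X s) (sourceLaw p₀ lamOn lamOff s) P
  indep : iIndepFun X P

/-- The duration of the first `k` on-off cycles of the edge `e`, for the realisation `x` of the
primitive variables. -/
noncomputable def cycleTime {N : ℕ} (x : Source N → ℝ) (e : Sym2 (Fin N)) (k : ℕ) : ℝ :=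
  (∑ l ∈ Finset.range k, x (.off e l)) + ∑ l ∈ Finset.range k, x (.on e l)

open Classical in
/-- The state at time `t` of the edge `e` (`1` for present, `0` for absent), for the realisation
`x` of the primitive variables. An edge that starts absent alternates off-time, on-time, off-time
and so on; an edge that starts present alternates on-time, off-time, on-time and so on. -/
noncomputable def edgeState {N : ℕ} (x : Source N → ℝ) (e : Sym2 (Fin N)) (t : ℝ) : ℝ :=
  if x (.init e) = 0 then
    if ∃ k : ℕ, t ∈ Set.Ico (cycleTime x e k) (cycleTime x e k + x (.off e k)) then 0 else 1
  else
    if ∃ k : ℕ, t ∈ Set.Ico (cycleTime x e k) (cycleTime x e k + x (.on e k)) then 1 else 0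

/-- The (symmetric) adjacency matrix of the graph at time `t`. -/
noncomputable def adjacency {N : ℕ} (x : Source N → ℝ) (t : ℝ) : Matrix (Fin N) (Fin N) ℝ :=
  Matrix.of fun i j => edgeState x s(i, j) t

/-- The principal (that is, largest) eigenvalue of a real symmetric matrix of size `N ≥ 1`. -/
noncomputable def principalEigenvalue {N : ℕ} (A : Matrix (Fin N) (Fin N) ℝ) : ℝ :=
  sSup {r : ℝ | Module.End.HasEigenvalue (Matrix.toLin' A) r}

end DynamicER

/-!
Write the adjacency matrix as `p 1 1ᵀ + W`, with `W` symmetric with independent centered entries.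
With `f` the unit vector proportional to `1` and `w` the top eigenvector, scaled so that
`⟪f, w⟫ = 1`, the eigenvalue equation `l w = N p f + W w` expresses each `⟪W ^ k f, w⟫` through
`⟪f, W ^ k f⟫` and `⟪W ^ (k + 1) f, w⟫`. Iterating it as long as `‖W‖ ≤ N p / 8` gives the
expansion of Füredi and Komlós,
`l = N p + ⟪f, W f⟫ + ⟪f, W² f⟫ / (N p) + ⟪f, W³ f⟫ / (N p)²`,
with an error of at most a constant times `⟪f, W f⟫² / (N p) + ⟪f, W⁴ f⟫ / (N p)³`. The expectation
of `⟪f, W ^ k f⟫` is a sum over walks of length `k`, to which only those walks contribute that use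
each of their edges at least twice; so the second order term contributes `1 - p`, while the cubic
term and the error are `O(1 / N)`. If `‖W‖` is larger than `N p / 8`, then the off-diagonal entries
of `W²` are exceptionally large, and their fourth moments show that this event is negligible.

At a fixed time the edges are independent Bernoulli variables with a common success probability,
which on `[0, T]` is bounded below by the probability `p₀ exp (-lamOn T)` that an edge is present at
time `0` and its first on-time exceeds `T`; hence all bounds are uniform in time.
-/

namespace DynamicER

open scoped RealInnerProductSpace

section RankOnePerturbation

variable {E : Type*} [NormedAddCommGroup E] [InnerProductSpace ℝ E] {f v w : E}
  {W : E →ₗ[ℝ] E} {θ l c : ℝ}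

lemma mul_inner_pow_apply (hW : W.IsSymmetric) (hw : l • w = f + W w) (k : ℕ) :
    l * ⟪(W ^ k) f, w⟫ = ⟪f, (W ^ k) f⟫ + ⟪(W ^ (k + 1)) f, w⟫ := by
  rw [← inner_smul_right, hw, inner_add_right, real_inner_comm, ← hW, pow_succ',
    Module.End.mul_apply]

lemma inner_pow_two_apply (hW : W.IsSymmetric) (x : E) : ⟪x, (W ^ 2) x⟫ = ‖W x‖ ^ 2 := by
  rw [pow_two, Module.End.mul_apply, ← hW, real_inner_self_eq_norm_sq]

lemma inner_pow_four_apply (hW : W.IsSymmetric) (x : E) :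
    ⟪x, (W ^ 4) x⟫ = ‖(W ^ 2) x‖ ^ 2 := by
  rw [← inner_pow_two_apply (hW.pow 2), ← pow_mul]

lemma abs_inner_pow_three_apply_le (hW : W.IsSymmetric) (hc : ∀ x, ‖W x‖ ≤ c * ‖x‖) (x : E) :
    |⟪x, (W ^ 3) x⟫| ≤ c * ‖W x‖ ^ 2 := by
  have hcube : ⟪x, (W ^ 3) x⟫ = ⟪W x, W (W x)⟫ := hW _ _ |>.symm
  rw [hcube]
  calc |⟪W x, W (W x)⟫| ≤ ‖W x‖ * ‖W (W x)‖ := abs_real_inner_le_norm _ _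
    _ ≤ ‖W x‖ * (c * ‖W x‖) := by gcongr; exact hc _
    _ = c * ‖W x‖ ^ 2 := by ring

lemma abs_inner_apply_le (hf : ‖f‖ = 1) (hc : ∀ x, ‖W x‖ ≤ c * ‖x‖) : |⟪f, W f⟫| ≤ c := by
  have h := (abs_real_inner_le_norm f (W f)).trans_eq (by rw [hf, one_mul])
  exact h.trans ((hc f).trans_eq (by rw [hf, mul_one]))

lemma sub_mul_abs_inner_pow_four_apply_le (hW : W.IsSymmetric) (hc : ∀ x, ‖W x‖ ≤ c * ‖x‖)
    (hw : l • w = f + W w) (hl : 0 ≤ l) :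
    (l - c) * |⟪(W ^ 4) f, w⟫| ≤ ‖(W ^ 2) f‖ ^ 2 := by
  have hsplit : ⟪(W ^ 4) f, w⟫ = ⟪(W ^ 2) f, (W ^ 2) w⟫ := hW.pow 2 _ _
  rcases le_total l c with hlc | hlc
  · exact (mul_nonpos_of_nonpos_of_nonneg (sub_nonpos.2 hlc) (abs_nonneg _)).trans (sq_nonneg _)
  have hsq : l • (W ^ 2) w = (W ^ 2) f + W ((W ^ 2) w) := by
    rw [← map_smul, hw, map_add]
    rfl
  have hnorm : l * ‖(W ^ 2) w‖ ≤ ‖(W ^ 2) f‖ + c * ‖(W ^ 2) w‖ := by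
    rw [← Real.norm_of_nonneg hl, ← norm_smul, hsq]
    exact (norm_add_le _ _).trans (by gcongr; exact hc _)
  calc (l - c) * |⟪(W ^ 4) f, w⟫| ≤ (l - c) * (‖(W ^ 2) f‖ * ‖(W ^ 2) w‖) := by
        rw [hsplit]
        exact mul_le_mul_of_nonneg_left (abs_real_inner_le_norm _ _) (sub_nonneg.2 hlc)
    _ = ‖(W ^ 2) f‖ * (l * ‖(W ^ 2) w‖ - c * ‖(W ^ 2) w‖) := by ring
    _ ≤ ‖(W ^ 2) f‖ * ‖(W ^ 2) f‖ := by gcongr; linarith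
    _ = ‖(W ^ 2) f‖ ^ 2 := (sq _).symm

/- The recursion `l * a k = m k + a (k + 1)` with `a 0 = 1` says that `a 1 = l - 1`, so each step
replaces `a k` by `m k + a (k + 1)` at the price of the quadratic error `a 1 * a k`. -/
lemma abs_sub_one_sub_le_of_recursion {m a : ℕ → ℝ} (ha0 : a 0 = 1) (hm0 : m 0 = 1)
    (hrec : ∀ k, l * a k = m k + a (k + 1)) (hl : 7 / 8 ≤ l) (hm3 : |m 3| ≤ 1 / 8 * m 2)
    (hm24 : m 2 ^ 2 ≤ m 4) (hm42 : m 4 ≤ m 2 / 64) (ha4 : (l - 1 / 8) * |a 4| ≤ m 4) :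
    |l - 1 - m 1 - m 2 - m 3| ≤ 9 * (m 1 ^ 2 + m 4) := by
  have hm2 : 0 ≤ m 2 := by linarith [abs_nonneg (m 3)]
  have habs (k : ℕ) : 7 / 8 * |a k| ≤ |m k| + |a (k + 1)| := by
    have := abs_add_le (m k) (a (k + 1))
    rw [← hrec, abs_mul, abs_of_nonneg (by linarith)] at this
    nlinarith [abs_nonneg (a k)]
  have hb4 : |a 4| ≤ 4 / 3 * m 4 := by nlinarith [abs_nonneg (a 4)]
  have hb3 : |a 3| ≤ m 2 / 6 := by linarith [habs 3]
  have hb2 : |a 2| ≤ 4 / 3 * m 2 := by linarith [habs 2, abs_of_nonneg hm2]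
  have hb1 : |a 1| ≤ 8 / 7 * |m 1| + 32 / 21 * m 2 := by linarith [habs 1]
  have hl1 : l = 1 + a 1 := by linarith [hrec 0, congrArg (l * ·) ha0]
  have hexp : l - 1 - m 1 - m 2 - m 3 = a 4 - a 1 * (a 1 + a 2 + a 3) := by
    have h1 := hrec 1
    have h2 := hrec 2
    have h3 := hrec 3
    rw [hl1] at h1 h2 h3 ⊢
    linear_combination h1 + h2 + h3
  calc |l - 1 - m 1 - m 2 - m 3| ≤ |a 4| + |a 1| * (|a 1| + |a 2| + |a 3|) := by
        rw [hexp]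
        refine (abs_sub _ _).trans ?_
        rw [abs_mul]
        gcongr
        exact abs_add_three _ _ _
    _ ≤ 4 / 3 * m 4 + (8 / 7 * |m 1| + 32 / 21 * m 2)
          * (8 / 7 * |m 1| + 32 / 21 * m 2 + 4 / 3 * m 2 + m 2 / 6) := by gcongr
    _ ≤ 9 * (m 1 ^ 2 + m 4) := by nlinarith [sq_nonneg (|m 1| - m 2), sq_abs (m 1)]

lemma abs_sub_one_sub_le_of_smul_eq (hf : ‖f‖ = 1) (hW : W.IsSymmetric)
    (hc : ∀ x, ‖W x‖ ≤ 1 / 8 * ‖x‖) (hfw : ⟪f, w⟫ = 1) (hw : l • w = f + W w)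
    (hl : 1 + ⟪f, W f⟫ ≤ l) :
    |l - 1 - ⟪f, W f⟫ - ⟪f, (W ^ 2) f⟫ - ⟪f, (W ^ 3) f⟫|
      ≤ 9 * (⟪f, W f⟫ ^ 2 + ⟪f, (W ^ 4) f⟫) := by
  have hl' : 7 / 8 ≤ l := by linarith [neg_le_of_abs_le (abs_inner_apply_le hf hc)]
  have h24 : ⟪f, (W ^ 2) f⟫ ^ 2 ≤ ⟪f, (W ^ 4) f⟫ := by
    have h := abs_real_inner_le_norm f ((W ^ 2) f)
    rw [hf, one_mul] at h
    rw [inner_pow_four_apply hW]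
    exact sq_le_sq' (neg_le_of_abs_le h) (le_of_abs_le h)
  have h42 : ⟪f, (W ^ 4) f⟫ ≤ ⟪f, (W ^ 2) f⟫ / 64 := by
    rw [inner_pow_four_apply hW, inner_pow_two_apply hW]
    have h : ‖(W ^ 2) f‖ ≤ 1 / 8 * ‖W f‖ := hc (W f)
    calc ‖(W ^ 2) f‖ ^ 2 ≤ (1 / 8 * ‖W f‖) ^ 2 := by gcongr
      _ = ‖W f‖ ^ 2 / 64 := by ring
  refine abs_sub_one_sub_le_of_recursion (m := fun k => ⟪f, (W ^ k) f⟫)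
    (a := fun k => ⟪(W ^ k) f, w⟫) hfw ?_ (mul_inner_pow_apply hW hw) hl' ?_ h24 h42 ?_
  · simp [hf]
  · exact (abs_inner_pow_three_apply_le hW hc f).trans_eq (by rw [inner_pow_two_apply hW])
  · rw [inner_pow_four_apply hW]
    exact sub_mul_abs_inner_pow_four_apply_le hW hc hw (by linarith)

lemma inner_ne_zero_of_smul_eq (hc : ∀ x, ‖W x‖ ≤ c * ‖x‖) (hl : c < l) (hv0 : v ≠ 0)
    (hv : l • v = (θ * ⟪f, v⟫) • f + W v) : ⟪f, v⟫ ≠ 0 := by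
  intro h0
  rw [h0, mul_zero, zero_smul, zero_add] at hv
  have hnorm : l * ‖v‖ ≤ c * ‖v‖ := calc
    l * ‖v‖ ≤ |l| * ‖v‖ := by gcongr; exact le_abs_self l
    _ = ‖W v‖ := by rw [← hv, norm_smul, Real.norm_eq_abs]
    _ ≤ c * ‖v‖ := hc v
  exact hl.not_ge (le_of_mul_le_mul_right hnorm (norm_pos_iff.2 hv0))

theorem abs_sub_expansion_le_of_smul_eq (hf : ‖f‖ = 1) (hW : W.IsSymmetric) (hθ : 0 < θ)
    (hc : ∀ x, ‖W x‖ ≤ θ / 8 * ‖x‖) (hl : θ + ⟪f, W f⟫ ≤ l) (hv0 : v ≠ 0)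
    (hv : l • v = (θ * ⟪f, v⟫) • f + W v) :
    |l - θ - ⟪f, W f⟫ - ⟪f, (W ^ 2) f⟫ / θ - ⟪f, (W ^ 3) f⟫ / θ ^ 2|
      ≤ 9 * (⟪f, W f⟫ ^ 2 / θ + ⟪f, (W ^ 4) f⟫ / θ ^ 3) := by
  have hfv : ⟪f, v⟫ ≠ 0 := by
    refine inner_ne_zero_of_smul_eq hc ?_ hv0 hv
    linarith [neg_le_of_abs_le (abs_inner_apply_le hf hc)]
  have hscaled := abs_sub_one_sub_le_of_smul_eq (W := θ⁻¹ • W) (w := ⟪f, v⟫⁻¹ • v) (l := θ⁻¹ * l)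
    hf (hW.smul (by simp)) ?_ ?_ ?_ ?_
  · simp only [smul_pow, LinearMap.smul_apply, real_inner_smul_right] at hscaled
    have h1 : l - θ - ⟪f, W f⟫ - ⟪f, (W ^ 2) f⟫ / θ - ⟪f, (W ^ 3) f⟫ / θ ^ 2
        = θ * (θ⁻¹ * l - 1 - θ⁻¹ * ⟪f, W f⟫ - θ⁻¹ ^ 2 * ⟪f, (W ^ 2) f⟫
          - θ⁻¹ ^ 3 * ⟪f, (W ^ 3) f⟫) := by field_simp
    have h2 : 9 * (⟪f, W f⟫ ^ 2 / θ + ⟪f, (W ^ 4) f⟫ / θ ^ 3)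
        = θ * (9 * ((θ⁻¹ * ⟪f, W f⟫) ^ 2 + θ⁻¹ ^ 4 * ⟪f, (W ^ 4) f⟫)) := by field_simp
    rw [h1, h2, abs_mul, abs_of_pos hθ]
    gcongr
  · intro x
    rw [LinearMap.smul_apply, norm_smul, norm_inv, Real.norm_of_nonneg hθ.le,
      inv_mul_le_iff₀ hθ]
    exact (hc x).trans_eq (by ring)
  · rw [real_inner_smul_right, inv_mul_cancel₀ hfv]
  · rw [smul_comm, mul_smul, hv, map_smul, LinearMap.smul_apply, smul_add, smul_add, smul_smul,
      smul_smul, smul_comm]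
    congr 1
    rw [show ⟪f, v⟫⁻¹ * θ⁻¹ * (θ * ⟪f, v⟫) = 1 by field_simp, one_smul]
  · rw [LinearMap.smul_apply, real_inner_smul_right, le_inv_mul_iff₀ hθ]
    field_simp
    linarith

lemma abs_sub_le_of_smul_eq (hf : ‖f‖ = 1) (hθ : 0 ≤ θ) (hc : ∀ x, ‖W x‖ ≤ c * ‖x‖)
    (hl : θ + ⟪f, W f⟫ ≤ l) (hv0 : v ≠ 0) (hv : l • v = (θ * ⟪f, v⟫) • f + W v) :
    |l - θ| ≤ c := by
  refine abs_sub_le_iff.2 ⟨?_, by linarith [neg_le_of_abs_le (abs_inner_apply_le hf hc)]⟩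
  have hfv : ⟪f, v⟫ ^ 2 ≤ ‖v‖ ^ 2 := by
    have h := abs_real_inner_le_norm f v
    rw [hf, one_mul] at h
    exact sq_le_sq' (neg_le_of_abs_le h) (le_of_abs_le h)
  have hWv : ⟪v, W v⟫ ≤ ‖v‖ * (c * ‖v‖) :=
    (real_inner_le_norm _ _).trans (by gcongr; exact hc v)
  have hlv : l * ‖v‖ ^ 2 ≤ (θ + c) * ‖v‖ ^ 2 := calc
    l * ‖v‖ ^ 2 = θ * ⟪f, v⟫ ^ 2 + ⟪v, W v⟫ := by
      rw [← real_inner_self_eq_norm_sq, ← real_inner_smul_right, hv, inner_add_right,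
        real_inner_smul_right, real_inner_comm f v]
      ring
    _ ≤ θ * ‖v‖ ^ 2 + ‖v‖ * (c * ‖v‖) := by gcongr
    _ = (θ + c) * ‖v‖ ^ 2 := by ring
  linarith [le_of_mul_le_mul_right hlv (pow_pos (norm_pos_iff.2 hv0) 2)]

lemma abs_sub_expansion_le_of_abs_sub_le (hf : ‖f‖ = 1) (hW : W.IsSymmetric) (hθ : 0 < θ)
    (hc : ∀ x, ‖W x‖ ≤ c * ‖x‖) (hl : |l - θ| ≤ c) :
    |l - θ - ⟪f, W f⟫ - ⟪f, (W ^ 2) f⟫ / θ - ⟪f, (W ^ 3) f⟫ / θ ^ 2|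
      ≤ c * (2 + c / θ + c ^ 2 / θ ^ 2) := by
  have hc0 : 0 ≤ c := (abs_nonneg _).trans hl
  have hWf : ‖W f‖ ≤ c := by simpa [hf] using hc f
  have h2 : |⟪f, (W ^ 2) f⟫| ≤ c ^ 2 := by
    rw [inner_pow_two_apply hW, abs_of_nonneg (sq_nonneg _)]
    gcongr
  have h3 : |⟪f, (W ^ 3) f⟫| ≤ c ^ 3 := by
    calc |⟪f, (W ^ 3) f⟫| ≤ c * ‖W f‖ ^ 2 := abs_inner_pow_three_apply_le hW hc f
      _ ≤ c * c ^ 2 := by gcongr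
      _ = c ^ 3 := by ring
  calc |l - θ - ⟪f, W f⟫ - ⟪f, (W ^ 2) f⟫ / θ - ⟪f, (W ^ 3) f⟫ / θ ^ 2|
      ≤ |l - θ| + |⟪f, W f⟫| + |⟪f, (W ^ 2) f⟫ / θ| + |⟪f, (W ^ 3) f⟫ / θ ^ 2| := by
        refine (abs_sub _ _).trans ?_
        gcongr
        refine (abs_sub _ _).trans ?_
        gcongr
        exact abs_sub _ _
    _ ≤ c + c + c ^ 2 / θ + c ^ 3 / θ ^ 2 := by
        rw [abs_div, abs_div, abs_of_pos hθ, abs_of_pos (pow_pos hθ 2)]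
        gcongr
        exact abs_inner_apply_le hf hc
    _ = c * (2 + c / θ + c ^ 2 / θ ^ 2) := by ring

end RankOnePerturbation

open scoped Matrix.Norms.L2Operator

section OperatorNorm

variable {n : Type*} [Fintype n] [DecidableEq n]

lemma isSymmetric_toEuclideanLin {A : Matrix n n ℝ} (hA : A.IsSymm) :
    A.toEuclideanLin.IsSymmetric :=
  Matrix.isSymmetric_toEuclideanLin_iff.2 <| by
    rw [Matrix.IsHermitian, Matrix.conjTranspose_eq_transpose_of_trivial, hA.eq]

lemma hasEigenvalue_toEuclideanLin_iff {A : Matrix n n ℝ} {r : ℝ} :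
    Module.End.HasEigenvalue A.toEuclideanLin r ↔
      Module.End.HasEigenvalue (Matrix.toLin' A) r := by
  rw [Module.End.hasEigenvalue_iff_mem_spectrum, Module.End.hasEigenvalue_iff_mem_spectrum,
    Matrix.spectrum_toLpLin 2, Matrix.spectrum_toLin']

lemma norm_toEuclideanLin_apply_le (M : Matrix n n ℝ) (x : EuclideanSpace ℝ n) :
    ‖M.toEuclideanLin x‖ ≤ ‖M‖ * ‖x‖ :=
  M.l2_opNorm_mulVec x

lemma norm_sq_le_sum_sq (M : Matrix n n ℝ) : ‖M‖ ^ 2 ≤ ∑ i, ∑ j, M i j ^ 2 := by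
  have hsum : 0 ≤ ∑ i, ∑ j, M i j ^ 2 := by positivity
  rw [← Real.le_sqrt (norm_nonneg _) hsum, Matrix.l2_opNorm_def]
  refine ContinuousLinearMap.opNorm_le_bound _ (Real.sqrt_nonneg _) fun x => ?_
  refine (sq_le_sq₀ (norm_nonneg _) (by positivity)).1 ?_
  rw [mul_pow, Real.sq_sqrt hsum, EuclideanSpace.real_norm_sq_eq, Finset.sum_mul]
  gcongr with i
  exact (Finset.sum_mul_sq_le_sq_mul_sq _ _ _).trans_eq
    (congrArg _ (EuclideanSpace.real_norm_sq_eq x).symm)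

lemma norm_le_card_mul {M : Matrix n n ℝ} {K : ℝ} (hK : 0 ≤ K) (hM : ∀ i j, |M i j| ≤ K) :
    ‖M‖ ≤ Fintype.card n * K := by
  refine (sq_le_sq₀ (norm_nonneg _) (by positivity)).1 ?_
  calc ‖M‖ ^ 2 ≤ ∑ i, ∑ j, M i j ^ 2 := norm_sq_le_sum_sq M
    _ ≤ ∑ _i : n, ∑ _j : n, K ^ 2 := by
        refine Finset.sum_le_sum fun i _ => Finset.sum_le_sum fun j _ => ?_
        exact sq_le_sq.2 ((hM i j).trans (le_abs_self K))
    _ = (Fintype.card n * K) ^ 2 := by simp; ring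

lemma norm_le_add_sqrt_offDiag {M : Matrix n n ℝ} {D : ℝ} (hD : 0 ≤ D)
    (hM : ∀ i, |M i i| ≤ D) :
    ‖M‖ ≤ D + √(∑ i, ∑ j, if i = j then 0 else M i j ^ 2) := by
  set O : Matrix n n ℝ := M - Matrix.diagonal M.diag
  have hO : ∑ i, ∑ j, O i j ^ 2 = ∑ i, ∑ j, if i = j then 0 else M i j ^ 2 := by
    refine Finset.sum_congr rfl fun i _ => Finset.sum_congr rfl fun j _ => ?_
    split_ifs with h
    · simp [O, h]
    · simp [O, h]
  calc ‖M‖ = ‖Matrix.diagonal M.diag + O‖ := by rw [add_sub_cancel]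
    _ ≤ ‖(Matrix.diagonal M.diag : Matrix n n ℝ)‖ + ‖O‖ := norm_add_le _ _
    _ ≤ D + √(∑ i, ∑ j, if i = j then 0 else M i j ^ 2) := by
        gcongr
        · rw [Matrix.l2_opNorm_diagonal]
          exact (pi_norm_le_iff_of_nonneg hD).2 hM
        · rw [← hO]
          exact Real.le_sqrt_of_sq_le (norm_sq_le_sum_sq O)

variable {W : Matrix n n ℝ} {K θ : ℝ}

lemma norm_sq_le_of_isSymm (hW : W.IsSymm) (hK : ∀ i j, |W i j| ≤ K) :
    ‖W‖ ^ 2 ≤ Fintype.card n * K ^ 2 + √(∑ i, ∑ j, if i = j then 0 else (W ^ 2) i j ^ 2) := by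
  have hnorm : ‖W‖ ^ 2 = ‖W ^ 2‖ := by
    rw [sq, ← Matrix.l2_opNorm_conjTranspose_mul_self,
      Matrix.conjTranspose_eq_transpose_of_trivial, hW.eq, sq]
  rw [hnorm]
  refine norm_le_add_sqrt_offDiag (by positivity) fun i => ?_
  calc |(W ^ 2) i i| ≤ ∑ k, |W i k * W k i| := by
        rw [sq, Matrix.mul_apply]
        exact Finset.abs_sum_le_sum_abs _ _
    _ ≤ ∑ _k : n, K * K := by
        gcongr with k
        rw [abs_mul]
        gcongr
        · exact (abs_nonneg _).trans (hK i k)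
        · exact hK i k
        · exact hK k i
    _ = Fintype.card n * K ^ 2 := by simp [sq]

lemma pow_eight_le_of_lt_norm (hW : W.IsSymm) (hK : ∀ i j, |W i j| ≤ K)
    (hKθ : 128 * (Fintype.card n * K ^ 2) ≤ θ ^ 2) (hθ : 0 ≤ θ) (hlt : θ / 8 < ‖W‖) :
    θ ^ 8 ≤ 2 ^ 28 * Fintype.card n ^ 2 * ∑ i, ∑ j, if i = j then 0 else (W ^ 2) i j ^ 4 := by
  set F := ∑ i, ∑ j, if i = j then 0 else (W ^ 2) i j ^ 2 with hF
  have hF0 : 0 ≤ F :=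
    Finset.sum_nonneg fun i _ => Finset.sum_nonneg fun j _ => by split_ifs <;> positivity
  have hsqrt : θ ^ 2 ≤ 128 * √F := by
    have h := norm_sq_le_of_isSymm hW hK
    have hsq : (θ / 8) ^ 2 ≤ ‖W‖ ^ 2 := by gcongr
    linarith
  have hCS : F ^ 2 ≤ Fintype.card n ^ 2 * ∑ i, ∑ j, if i = j then 0 else (W ^ 2) i j ^ 4 := by
    simp only [hF, ← Fintype.sum_prod_type']
    refine sq_sum_le_card_mul_sum_sq.trans_eq ?_
    simp only [Finset.card_univ, Fintype.card_prod, ← sq, ite_pow, ← pow_mul]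
    simp
  calc θ ^ 8 = (θ ^ 2) ^ 4 := by ring
    _ ≤ (128 * √F) ^ 4 := by gcongr
    _ = 2 ^ 28 * (√F ^ 2) ^ 2 := by ring
    _ = 2 ^ 28 * F ^ 2 := by rw [Real.sq_sqrt hF0]
    _ ≤ _ := by rw [mul_assoc]; gcongr

end OperatorNorm

section PrincipalEigenvalue

variable {N : ℕ} [NeZero N] {A B : Matrix (Fin N) (Fin N) ℝ}

lemma hasEigenvalue_principalEigenvalue (hA : A.IsSymm) :
    Module.End.HasEigenvalue A.toEuclideanLin (principalEigenvalue A) := by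
  have h := (isSymmetric_toEuclideanLin hA).hasEigenvalue_iSup_of_finiteDimensional
  rw [hasEigenvalue_toEuclideanLin_iff] at h ⊢
  exact Set.Nonempty.csSup_mem ⟨_, h⟩ (Module.End.finite_hasEigenvalue _)

theorem inner_toEuclideanLin_apply_le (hA : A.IsSymm) (x : EuclideanSpace ℝ (Fin N)) :
    ⟪x, A.toEuclideanLin x⟫ ≤ principalEigenvalue A * ‖x‖ ^ 2 := by
  rcases eq_or_ne x 0 with rfl | hx
  · simp
  set S := A.toEuclideanLin.toContinuousLinearMap
  have hbdd : BddAbove (Set.range fun y : {y : EuclideanSpace ℝ (Fin N) // y ≠ 0} =>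
      S.rayleighQuotient y) := by
    refine ⟨‖S‖, ?_⟩
    rintro _ ⟨y, rfl⟩
    exact le_of_abs_le (S.rayleighQuotient_le_norm y)
  have hsup := (isSymmetric_toEuclideanLin hA).hasEigenvalue_iSup_of_finiteDimensional
  rw [hasEigenvalue_toEuclideanLin_iff] at hsup
  rw [← div_le_iff₀ (pow_pos (norm_pos_iff.2 hx) 2), real_inner_comm]
  exact (le_ciSup hbdd ⟨x, hx⟩).trans
    (le_csSup (Module.End.finite_hasEigenvalue _).bddAbove hsup)

lemma principalEigenvalue_le_add_norm_sub (hA : A.IsSymm) (hB : B.IsSymm) :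
    principalEigenvalue A ≤ principalEigenvalue B + ‖A - B‖ := by
  obtain ⟨v, hv, hv0⟩ := (hasEigenvalue_principalEigenvalue hA).exists_hasEigenvector
  rw [Module.End.mem_eigenspace_iff] at hv
  refine le_of_mul_le_mul_right ?_ (pow_pos (norm_pos_iff.2 hv0) 2)
  calc principalEigenvalue A * ‖v‖ ^ 2 = ⟪v, A.toEuclideanLin v⟫ := by
        rw [hv, real_inner_smul_right, real_inner_self_eq_norm_sq]
    _ = ⟪v, B.toEuclideanLin v⟫ + ⟪v, (A - B).toEuclideanLin v⟫ := by
        rw [map_sub, LinearMap.sub_apply, inner_sub_right]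
        ring
    _ ≤ principalEigenvalue B * ‖v‖ ^ 2 + ‖v‖ * (‖A - B‖ * ‖v‖) :=
        add_le_add (inner_toEuclideanLin_apply_le hB v)
          ((real_inner_le_norm _ _).trans (by gcongr; exact norm_toEuclideanLin_apply_le _ v))
    _ = (principalEigenvalue B + ‖A - B‖) * ‖v‖ ^ 2 := by ring

lemma lipschitzOnWith_principalEigenvalue :
    LipschitzOnWith 1 (principalEigenvalue (N := N)) {A | A.IsSymm} :=
  LipschitzOnWith.of_le_add fun A hA B hB =>
    (principalEigenvalue_le_add_norm_sub hA hB).trans_eq (by rw [dist_eq_norm])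

end PrincipalEigenvalue

section SymMatrix

variable {V : Type*}

/-- The symmetric matrix with entry `a s(i, j)` in position `(i, j)`: the weighted adjacency
matrix of the graph, loops allowed, whose edge weights are `a`. -/
def symMatrix (a : Sym2 V → ℝ) : Matrix V V ℝ := Matrix.of fun i j => a s(i, j)

lemma symMatrix_apply (a : Sym2 V → ℝ) (i j : V) : symMatrix a i j = a s(i, j) := rfl

lemma isSymm_symMatrix (a : Sym2 V → ℝ) : (symMatrix a).IsSymm :=
  Matrix.IsSymm.ext fun _ _ => congrArg a Sym2.eq_swap

lemma symMatrix_const_add (μ : ℝ) (a : Sym2 V → ℝ) :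
    symMatrix (fun e => μ + a e) = symMatrix a + Matrix.of fun _ _ => μ := by
  ext i j
  exact add_comm _ _

lemma continuous_symMatrix : Continuous (symMatrix (V := V)) :=
  continuous_matrix fun _ _ => continuous_apply _

lemma continuous_principalEigenvalue_symMatrix {N : ℕ} [NeZero N] :
    Continuous fun a : Sym2 (Fin N) → ℝ => principalEigenvalue (symMatrix a) :=
  lipschitzOnWith_principalEigenvalue.continuousOn.comp_continuous continuous_symMatrix
    isSymm_symMatrix

end SymMatrix

section MeanFieldPerturbation

variable {N : ℕ}

/-- The unit vector with equal coordinates. -/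
noncomputable def flatVector (N : ℕ) : EuclideanSpace ℝ (Fin N) :=
  WithLp.toLp 2 fun _ => (√N)⁻¹

/-- The error of the third order expansion, in powers of `W`, of the principal eigenvalue of the
symmetric matrix `W + μ 1 1ᵀ`: the term of order `k` is the quadratic form of `W ^ k` at the
normalised all-ones vector, divided by `(N μ) ^ (k - 1)`. -/
noncomputable def expansionError (μ : ℝ) (W : Matrix (Fin N) (Fin N) ℝ) : ℝ :=
  principalEigenvalue (W + Matrix.of fun _ _ => μ) - N * μ - (∑ i, ∑ j, W i j) / N
    - (∑ i, ∑ j, (W ^ 2) i j) / N / (N * μ) - (∑ i, ∑ j, (W ^ 3) i j) / N / (N * μ) ^ 2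

variable {W : Matrix (Fin N) (Fin N) ℝ} {μ : ℝ}

lemma inner_flatVector_toEuclideanLin_pow (k : ℕ) :
    ⟪flatVector N, (W.toEuclideanLin ^ k) (flatVector N)⟫ = (∑ i, ∑ j, (W ^ k) i j) / N := by
  rw [← Matrix.toLpLin_pow, Matrix.toLpLin_apply, PiLp.inner_apply]
  simp only [flatVector, Matrix.mulVec, dotProduct, ← Finset.sum_mul, RCLike.inner_apply,
    conj_trivial]
  rw [mul_assoc, ← sq, inv_pow, Real.sq_sqrt (Nat.cast_nonneg N), div_eq_mul_inv]

lemma isSymm_add_const (hW : W.IsSymm) : (W + Matrix.of fun _ _ => μ).IsSymm :=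
  hW.add (Matrix.IsSymm.ext fun _ _ => rfl)

lemma expansionError_eq :
    expansionError μ W = principalEigenvalue (W + Matrix.of fun _ _ => μ) - N * μ
      - ⟪flatVector N, W.toEuclideanLin (flatVector N)⟫
      - ⟪flatVector N, (W.toEuclideanLin ^ 2) (flatVector N)⟫ / (N * μ)
      - ⟪flatVector N, (W.toEuclideanLin ^ 3) (flatVector N)⟫ / (N * μ) ^ 2 := by
  have h := inner_flatVector_toEuclideanLin_pow (W := W) 1
  rw [pow_one, pow_one] at h
  rw [h, inner_flatVector_toEuclideanLin_pow, inner_flatVector_toEuclideanLin_pow, expansionError]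

variable [NeZero N]

lemma norm_flatVector : ‖flatVector N‖ = 1 := by
  have hN : (N : ℝ) ≠ 0 := NeZero.ne _
  rw [EuclideanSpace.norm_eq]
  simp [flatVector, hN]

lemma toEuclideanLin_add_const_apply (v : EuclideanSpace ℝ (Fin N)) :
    (W + Matrix.of fun _ _ => μ).toEuclideanLin v
      = (N * μ * ⟪flatVector N, v⟫) • flatVector N + W.toEuclideanLin v := by
  rw [map_add, LinearMap.add_apply, add_comm]
  congr 1
  have hN : (N : ℝ) * (√N)⁻¹ * (√N)⁻¹ = 1 := by
    rw [mul_assoc, ← sq, inv_pow, Real.sq_sqrt (Nat.cast_nonneg N),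
      mul_inv_cancel₀ (NeZero.ne _)]
  ext i
  simp only [Matrix.toLpLin_apply, Matrix.mulVec, dotProduct, Matrix.of_apply, flatVector,
    PiLp.inner_apply, RCLike.inner_apply, conj_trivial, PiLp.smul_apply, smul_eq_mul,
    ← Finset.mul_sum, ← Finset.sum_mul]
  linear_combination -(μ * ∑ i, v.ofLp i) * hN

lemma exists_principalEigenvalue_add_const_smul_eq (hW : W.IsSymm) :
    ∃ v : EuclideanSpace ℝ (Fin N), v ≠ 0 ∧
      principalEigenvalue (W + Matrix.of fun _ _ => μ) • v
        = (N * μ * ⟪flatVector N, v⟫) • flatVector N + W.toEuclideanLin v := by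
  obtain ⟨v, hv, hv0⟩ :=
    (hasEigenvalue_principalEigenvalue (isSymm_add_const (μ := μ) hW)).exists_hasEigenvector
  rw [Module.End.mem_eigenspace_iff, toEuclideanLin_add_const_apply] at hv
  exact ⟨v, hv0, hv.symm⟩

lemma add_inner_flatVector_le_principalEigenvalue (hW : W.IsSymm) :
    N * μ + ⟪flatVector N, W.toEuclideanLin (flatVector N)⟫
      ≤ principalEigenvalue (W + Matrix.of fun _ _ => μ) := by
  have h := inner_toEuclideanLin_apply_le (isSymm_add_const (μ := μ) hW) (flatVector N)
  rw [toEuclideanLin_add_const_apply, inner_add_right, real_inner_smul_right,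
    real_inner_self_eq_norm_sq, norm_flatVector] at h
  linarith

theorem abs_expansionError_le_of_norm_le (hW : W.IsSymm) (hμ : 0 < μ)
    (hnorm : ‖W‖ ≤ N * μ / 8) :
    |expansionError μ W| ≤ 9 * (((∑ i, ∑ j, W i j) / N) ^ 2 / (N * μ)
      + (∑ i, ∑ j, (W ^ 4) i j) / N / (N * μ) ^ 3) := by
  have hθ : 0 < N * μ := mul_pos (Nat.cast_pos.2 (NeZero.pos N)) hμ
  obtain ⟨v, hv0, hv⟩ := exists_principalEigenvalue_add_const_smul_eq (μ := μ) hW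
  have h := abs_sub_expansion_le_of_smul_eq norm_flatVector (isSymmetric_toEuclideanLin hW) hθ
    (fun x => (norm_toEuclideanLin_apply_le W x).trans (by gcongr))
    (add_inner_flatVector_le_principalEigenvalue hW) hv0 hv
  rwa [← expansionError_eq, inner_flatVector_toEuclideanLin_pow,
    ← pow_one (Matrix.toEuclideanLin W), inner_flatVector_toEuclideanLin_pow, pow_one] at h

theorem abs_expansionError_le (hW : W.IsSymm) (hμ : 0 < μ) :
    |expansionError μ W| ≤ ‖W‖ * (2 + ‖W‖ / (N * μ) + ‖W‖ ^ 2 / (N * μ) ^ 2) := by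
  have hθ : 0 < N * μ := mul_pos (Nat.cast_pos.2 (NeZero.pos N)) hμ
  obtain ⟨v, hv0, hv⟩ := exists_principalEigenvalue_add_const_smul_eq (μ := μ) hW
  rw [expansionError_eq]
  exact abs_sub_expansion_le_of_abs_sub_le norm_flatVector (isSymmetric_toEuclideanLin hW) hθ
    (norm_toEuclideanLin_apply_le W) (abs_sub_le_of_smul_eq norm_flatVector hθ.le
      (norm_toEuclideanLin_apply_le W) (add_inner_flatVector_le_principalEigenvalue hW) hv0 hv)

theorem abs_expansionError_le_of_abs_le {K : ℝ} (hW : W.IsSymm) (hμ : 0 < μ) (hK0 : 0 ≤ K)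
    (hK : ∀ i j, |W i j| ≤ K) (hN : 128 * K ^ 2 ≤ μ ^ 2 * N) :
    |expansionError μ W| ≤ 9 * (((∑ i, ∑ j, W i j) / N) ^ 2 / (N * μ)
        + (∑ i, ∑ j, (W ^ 4) i j) / N / (N * μ) ^ 3)
      + K * (2 + K / μ + K ^ 2 / μ ^ 2) * 2 ^ 28 / (μ ^ 8 * N ^ 5)
        * ∑ i, ∑ j, if i = j then 0 else (W ^ 2) i j ^ 4 := by
  have hNpos : 0 < (N : ℝ) := Nat.cast_pos.2 (NeZero.pos N)
  rcases le_or_gt ‖W‖ (N * μ / 8) with hle | hlt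
  · refine (abs_expansionError_le_of_norm_le hW hμ hle).trans (le_add_of_nonneg_right ?_)
    positivity
  have hθ : 128 * (Fintype.card (Fin N) * K ^ 2) ≤ (N * μ) ^ 2 := by
    rw [Fintype.card_fin]
    nlinarith
  have h8 := pow_eight_le_of_lt_norm hW hK hθ (by positivity) hlt
  have hnorm := norm_le_card_mul hK0 hK
  rw [Fintype.card_fin] at h8 hnorm
  set G := ∑ i, ∑ j, if i = j then 0 else (W ^ 2) i j ^ 4
  have hS4 : 0 ≤ (∑ i, ∑ j, (W ^ 4) i j) / N := by
    rw [← inner_flatVector_toEuclideanLin_pow,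
      inner_pow_four_apply (isSymmetric_toEuclideanLin hW)]
    positivity
  calc |expansionError μ W|
      ≤ ‖W‖ * (2 + ‖W‖ / (N * μ) + ‖W‖ ^ 2 / (N * μ) ^ 2) := abs_expansionError_le hW hμ
    _ ≤ N * K * (2 + N * K / (N * μ) + (N * K) ^ 2 / (N * μ) ^ 2) := by gcongr
    _ = N * K * (2 + K / μ + K ^ 2 / μ ^ 2) := by
        rw [mul_div_mul_left _ _ hNpos.ne', ← div_pow, mul_div_mul_left _ _ hNpos.ne', div_pow]
    _ ≤ N * K * (2 + K / μ + K ^ 2 / μ ^ 2) * (2 ^ 28 * N ^ 2 * G / (N * μ) ^ 8) :=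
        le_mul_of_one_le_right (by positivity) ((one_le_div (by positivity)).2 h8)
    _ = K * (2 + K / μ + K ^ 2 / μ ^ 2) * 2 ^ 28 / (μ ^ 8 * N ^ 5) * G := by
        field_simp
    _ ≤ _ := le_add_of_nonneg_left (by positivity)

end MeanFieldPerturbation

section Words

variable {κ ι V α : Type*}

/-- A word in which every letter occurs at least twice. -/
def IsRepeating (e : κ → ι) : Prop := ∀ r, ∃ s ≠ r, e s = e r

lemma IsRepeating.fin_three {e : Fin 3 → ι} (he : IsRepeating e) : e 0 = e 1 ∧ e 1 = e 2 := by
  obtain ⟨a, ha, h0⟩ := he 0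
  obtain ⟨b, hb, h1⟩ := he 1
  obtain ⟨c, hc, h2⟩ := he 2
  grind

lemma IsRepeating.fin_four {e : Fin 4 → ι} (he : IsRepeating e) :
    e 0 = e 1 ∧ e 2 = e 3 ∨ e 0 = e 2 ∧ e 1 = e 3 ∨ e 0 = e 3 ∧ e 1 = e 2 := by
  obtain ⟨a, ha, h0⟩ := he 0
  obtain ⟨b, hb, h1⟩ := he 1
  obtain ⟨c, hc, h2⟩ := he 2
  obtain ⟨d, hd, h3⟩ := he 3
  fin_cases a <;> fin_cases b <;> grind

lemma card_le_card_mul_pow_of_forall_exists [Fintype V] {C d : ℕ} {s : Finset α}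
    (F : Fin C → (Fin d → V) → α) (hF : ∀ a ∈ s, ∃ c p, F c p = a) :
    s.card ≤ C * Fintype.card V ^ d := by
  classical
  calc s.card ≤ (Finset.univ.image (Function.uncurry F)).card := by
        refine Finset.card_le_card fun a ha => ?_
        obtain ⟨c, p, rfl⟩ := hF a ha
        exact Finset.mem_image_of_mem (Function.uncurry F) (Finset.mem_univ (c, p))
    _ ≤ Fintype.card (Fin C × (Fin d → V)) := Finset.card_image_le
    _ = C * Fintype.card V ^ d := by simp

/-- The `r`-th edge of the walk with vertices `q`. -/
def walkEdge {m : ℕ} (q : Fin (m + 1) → V) (r : Fin m) : Sym2 V := s(q r.castSucc, q r.succ)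

/-- The `r`-th edge of the concatenation of the paths of length two from `i` to `j` with middle
vertices `q`, for a label `r` consisting of the index of the path and of a choice between its first
(`false`) and its second (`true`) edge. -/
def pathEdge {m : ℕ} (i j : V) (q : Fin m → V) (r : Fin m × Bool) : Sym2 V :=
  s(q r.1, if r.2 then j else i)

open Classical in
lemma card_isRepeating_sym2_mk_le [Fintype V] :
    (Finset.univ.filter fun q : Fin 2 → V × V =>
      IsRepeating fun r => s((q r).1, (q r).2)).card ≤ 2 * Fintype.card V ^ 2 := by
  refine (card_le_card_mul_pow_of_forall_exists (V := V × V) (C := 2) (d := 1)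
    ![fun p => ![p 0, p 0], fun p => ![p 0, (p 0).swap]] fun q hq => ?_).trans_eq ?_
  · obtain ⟨s, hs, h⟩ := (Finset.mem_filter.1 hq).2 0
    obtain rfl : s = 1 := by omega
    rcases Sym2.mk_eq_mk_iff.1 h with h | h
    · exact ⟨0, fun _ => q 0, by ext r <;> fin_cases r <;> simp [h]⟩
    · exact ⟨1, fun _ => q 0, by ext r <;> fin_cases r <;> simp [h]⟩
  · simp [sq]

lemma eq_of_isRepeating_walkEdge_three {q : Fin 4 → V} (hq : IsRepeating (walkEdge q)) :
    q 0 = q 2 ∧ q 1 = q 3 := by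
  obtain ⟨h1 : s(q 0, q 1) = s(q 1, q 2), h2 : s(q 1, q 2) = s(q 2, q 3)⟩ := hq.fin_three
  rw [Sym2.eq_iff] at h1 h2
  grind

lemma eq_of_isRepeating_walkEdge_four {q : Fin 5 → V} (hq : IsRepeating (walkEdge q)) :
    q 0 = q 4 ∧ (q 0 = q 2 ∨ q 1 = q 3) := by
  have h : s(q 0, q 1) = s(q 1, q 2) ∧ s(q 2, q 3) = s(q 3, q 4) ∨
      s(q 0, q 1) = s(q 2, q 3) ∧ s(q 1, q 2) = s(q 3, q 4) ∨
      s(q 0, q 1) = s(q 3, q 4) ∧ s(q 1, q 2) = s(q 2, q 3) := hq.fin_four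
  simp only [Sym2.eq_iff] at h
  grind

open Classical in
lemma card_isRepeating_walkEdge_three_le [Fintype V] :
    (Finset.univ.filter fun q : Fin 4 → V => IsRepeating (walkEdge q)).card
      ≤ Fintype.card V ^ 2 := by
  refine (card_le_card_mul_pow_of_forall_exists
    ![fun p => ![p 0, p 1, p 0, p 1]] fun q hq => ?_).trans_eq (one_mul _)
  obtain ⟨h1, h2⟩ := eq_of_isRepeating_walkEdge_three (Finset.mem_filter.1 hq).2
  exact ⟨0, ![q 0, q 1], by ext r; fin_cases r <;> simp [h1, h2]⟩

open Classical in
lemma card_isRepeating_walkEdge_four_le [Fintype V] :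
    (Finset.univ.filter fun q : Fin 5 → V => IsRepeating (walkEdge q)).card
      ≤ 2 * Fintype.card V ^ 3 := by
  refine card_le_card_mul_pow_of_forall_exists
    ![fun p => ![p 0, p 1, p 0, p 2, p 0], fun p => ![p 0, p 1, p 2, p 1, p 0]] fun q hq => ?_
  obtain ⟨h4, h2 | h3⟩ := eq_of_isRepeating_walkEdge_four (Finset.mem_filter.1 hq).2
  · exact ⟨0, ![q 0, q 1, q 3], by ext r; fin_cases r <;> simp [h4, ← h2]⟩
  · exact ⟨1, ![q 0, q 1, q 2], by ext r; fin_cases r <;> simp [h4, ← h3]⟩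

lemma isRepeating_of_isRepeating_pathEdge {m : ℕ} {i j : V} (hij : i ≠ j) {q : Fin m → V}
    (hq : IsRepeating (pathEdge i j q)) : IsRepeating q := by
  intro r
  obtain ⟨⟨s, b⟩, hne, hs⟩ := hq (r, false)
  obtain ⟨⟨t, c⟩, hne', ht⟩ := hq (r, true)
  rw [pathEdge, pathEdge, Sym2.eq_iff] at hs ht
  by_contra! h
  have := h s
  have := h t
  grind

open Classical in
lemma card_isRepeating_fin_four_le [Fintype V] :
    (Finset.univ.filter fun q : Fin 4 → V => IsRepeating q).card ≤ 3 * Fintype.card V ^ 2 := by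
  refine card_le_card_mul_pow_of_forall_exists
    ![fun p => ![p 0, p 0, p 1, p 1], fun p => ![p 0, p 1, p 0, p 1],
      fun p => ![p 0, p 1, p 1, p 0]] fun q hq => ?_
  obtain ⟨h1, h2⟩ | ⟨h1, h2⟩ | ⟨h1, h2⟩ := (Finset.mem_filter.1 hq).2.fin_four
  · exact ⟨0, ![q 0, q 2], by ext r; fin_cases r <;> simp [h1, h2]⟩
  · exact ⟨1, ![q 0, q 1], by ext r; fin_cases r <;> simp [h1, h2]⟩
  · exact ⟨2, ![q 0, q 1], by ext r; fin_cases r <;> simp [h1, h2]⟩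

variable [Fintype V]

lemma sq_sum_symMatrix_eq_sum_pairs (y : Sym2 V → ℝ) :
    (∑ i, ∑ j, symMatrix y i j) ^ 2
      = ∑ q : Fin 2 → V × V, ∏ r, y s((q r).1, (q r).2) := by
  calc (∑ i, ∑ j, symMatrix y i j) ^ 2 = (∑ p : V × V, y s(p.1, p.2)) ^ 2 := by
        rw [Fintype.sum_prod_type]
        rfl
    _ = _ := Fintype.sum_pow _ _

variable [DecidableEq V]

lemma sum_pow_apply_eq_sum_prod (W : Matrix V V ℝ) (m : ℕ) (i : V) :
    ∑ j, (W ^ m) i j = ∑ q : Fin m → V, ∏ r : Fin m,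
      W ((Fin.cons i q : Fin (m + 1) → V) r.castSucc) (q r) := by
  induction m generalizing i with
  | zero => simp [Matrix.one_apply]
  | succ m ih =>
    rw [← (Fin.consEquiv fun _ : Fin (m + 1) => V).sum_comp, Fintype.sum_prod_type]
    simp only [pow_succ', Matrix.mul_apply]
    rw [Finset.sum_comm]
    simp only [← Finset.mul_sum, ih, Fin.prod_univ_succ, Fin.consEquiv_apply, Fin.castSucc_zero,
      Fin.cons_zero, Fin.cons_succ, ← Fin.succ_castSucc]

lemma sum_symMatrix_pow_eq_sum_walks (y : Sym2 V → ℝ) (m : ℕ) :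
    ∑ i, ∑ j, (symMatrix y ^ m) i j = ∑ q : Fin (m + 1) → V, ∏ r, y (walkEdge q r) := by
  rw [← (Fin.consEquiv fun _ : Fin (m + 1) => V).sum_comp, Fintype.sum_prod_type]
  simp only [sum_pow_apply_eq_sum_prod, symMatrix_apply, walkEdge, Fin.consEquiv_apply,
    Fin.cons_succ]

lemma symMatrix_sq_apply_pow_eq_sum_paths (y : Sym2 V → ℝ) (m : ℕ) (i j : V) :
    (symMatrix y ^ 2) i j ^ m = ∑ q : Fin m → V, ∏ r, y (pathEdge i j q r) := by
  rw [sq, Matrix.mul_apply, Fintype.sum_pow]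
  refine Finset.sum_congr rfl fun q _ => ?_
  rw [Fintype.prod_prod_type]
  refine Finset.prod_congr rfl fun r _ => ?_
  rw [Fintype.prod_bool, mul_comm, symMatrix_apply, symMatrix_apply, Sym2.eq_swap (a := i)]
  rfl

end Words

section Moments

variable {ι κ Ω V : Type*} [MeasurableSpace Ω] {P : Measure Ω} {K : ℝ}

/-- A family of independent centered random variables bounded by `K`: the fluctuations of the
entries of a random symmetric matrix around their common mean. -/
structure IsCenteredNoise (P : Measure Ω) (K : ℝ) (Y : ι → Ω → ℝ) : Prop where
  measurable : ∀ e, Measurable (Y e)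
  abs_le : ∀ e ω, |Y e ω| ≤ K
  indep : iIndepFun Y P
  integral_eq_zero : ∀ e, ∫ ω, Y e ω ∂P = 0

namespace IsCenteredNoise

variable {Y : ι → Ω → ℝ}

lemma isProbabilityMeasure (hY : IsCenteredNoise P K Y) : IsProbabilityMeasure P :=
  hY.indep.isProbabilityMeasure

lemma nonneg (hY : IsCenteredNoise P K Y) (e : ι) : 0 ≤ K := by
  have := hY.isProbabilityMeasure
  obtain ⟨ω⟩ := nonempty_of_isProbabilityMeasure P
  exact (abs_nonneg _).trans (hY.abs_le e ω)

lemma integrable_comp [Finite ι] (hY : IsCenteredNoise P K Y) {g : (ι → ℝ) → ℝ}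
    (hg : Continuous g) : Integrable (fun ω => g fun e => Y e ω) P := by
  have := hY.isProbabilityMeasure
  have := Fintype.ofFinite ι
  obtain ⟨C, hC⟩ := (isCompact_Icc (a := fun _ : ι => -K) (b := fun _ => K)
    ).exists_bound_of_continuousOn hg.continuousOn
  exact .of_bound (hg.measurable.comp (measurable_pi_lambda _ hY.measurable)).aestronglyMeasurable C
    (ae_of_all _ fun ω => hC _
      ⟨fun e => (_root_.abs_le.1 (hY.abs_le e ω)).1, fun e => (_root_.abs_le.1 (hY.abs_le e ω)).2⟩)

lemma integrable_symMatrix [Finite V] {Y : Sym2 V → Ω → ℝ} (hY : IsCenteredNoise P K Y)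
    {g : Matrix V V ℝ → ℝ} (hg : Continuous g) :
    Integrable (fun ω => g (symMatrix fun e => Y e ω)) P :=
  hY.integrable_comp (hg.comp continuous_symMatrix)

variable [Fintype κ]

-- A letter occurring only once contributes its mean as a factor.
lemma integral_prod_eq_zero [Finite ι] (hY : IsCenteredNoise P K Y) {e : κ → ι}
    (he : ¬ IsRepeating e) : ∫ ω, ∏ r, Y (e r) ω ∂P = 0 := by
  classical
  have := Fintype.ofFinite ι
  obtain ⟨r, hr⟩ : ∃ r, ∀ s ≠ r, e s ≠ e r := by simpa [IsRepeating] using he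
  have hfib : ∀ ω, ∏ s, Y (e s) ω = ∏ i, Y i ω ^ (Finset.univ.filter fun s => e s = i).card := by
    intro ω
    simp_rw [← Finset.prod_fiberwise' Finset.univ e fun i => Y i ω, Finset.prod_const]
  have hone : (Finset.univ.filter fun s => e s = e r).card = 1 :=
    Finset.card_eq_one.2 ⟨r, by grind⟩
  simp_rw [hfib]
  rw [hY.indep.integral_fun_prod_comp (fun i => (hY.measurable i).aemeasurable)
    (f := fun i y => y ^ (Finset.univ.filter fun s => e s = i).card)
    fun i => (continuous_pow _).aestronglyMeasurable]
  exact Finset.prod_eq_zero (Finset.mem_univ (e r)) (by simpa [hone] using hY.integral_eq_zero _)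

lemma abs_integral_prod_le (hY : IsCenteredNoise P K Y) (e : κ → ι) :
    |∫ ω, ∏ r, Y (e r) ω ∂P| ≤ K ^ Fintype.card κ := by
  have := hY.isProbabilityMeasure
  have hprod (ω : Ω) : ‖∏ r, Y (e r) ω‖ ≤ K ^ Fintype.card κ := by
    rw [Real.norm_eq_abs, Finset.abs_prod, ← Finset.card_univ, ← Finset.prod_const]
    exact Finset.prod_le_prod (fun _ _ => abs_nonneg _) fun _ _ => hY.abs_le _ _
  simpa using norm_integral_le_of_norm_le_const (ae_of_all P hprod)

open Classical in
lemma abs_integral_sum_prod_le [Finite ι] (hY : IsCenteredNoise P K Y) {α : Type*} [Fintype α]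
    (e : α → κ → ι) :
    |∫ ω, ∑ q, ∏ r, Y (e q r) ω ∂P|
      ≤ (Finset.univ.filter fun q => IsRepeating (e q)).card * K ^ Fintype.card κ := by
  have hint (q : α) : Integrable (fun ω => ∏ r, Y (e q r) ω) P :=
    hY.integrable_comp (g := fun y => ∏ r, y (e q r)) (by fun_prop)
  rw [integral_finsetSum _ fun q _ => hint q, ← nsmul_eq_mul, ← Finset.sum_const,
    ← Finset.sum_filter_of_ne fun q _ h => not_imp_comm.1 hY.integral_prod_eq_zero h]
  exact (Finset.abs_sum_le_sum_abs _ _).trans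
    (Finset.sum_le_sum fun q _ => hY.abs_integral_prod_le _)

end IsCenteredNoise

section SymmetricMatrices

variable [Fintype V] {Y : Sym2 V → Ω → ℝ}

namespace IsCenteredNoise

lemma integral_sum_symMatrix (hY : IsCenteredNoise P K Y) :
    ∫ ω, ∑ i, ∑ j, symMatrix (fun e => Y e ω) i j ∂P = 0 := by
  have hint (e : Sym2 V) : Integrable (Y e) P := hY.integrable_comp (continuous_apply e)
  simp only [symMatrix_apply]
  rw [integral_finsetSum _ fun i _ => integrable_finsetSum _ fun j _ => hint _]
  refine Finset.sum_eq_zero fun i _ => ?_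
  rw [integral_finsetSum _ fun j _ => hint _]
  exact Finset.sum_eq_zero fun j _ => hY.integral_eq_zero _

lemma integral_sq_sum_symMatrix_le (hY : IsCenteredNoise P K Y) :
    ∫ ω, (∑ i, ∑ j, symMatrix (fun e => Y e ω) i j) ^ 2 ∂P ≤ 2 * Fintype.card V ^ 2 * K ^ 2 := by
  simp only [sq_sum_symMatrix_eq_sum_pairs]
  refine (le_abs_self _).trans ((hY.abs_integral_sum_prod_le
    fun (q : Fin 2 → V × V) r => s((q r).1, (q r).2)).trans ?_)
  rw [Fintype.card_fin]
  gcongr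
  exact_mod_cast card_isRepeating_sym2_mk_le

variable [DecidableEq V]

lemma integral_symMatrix_sq_apply (hY : IsCenteredNoise P K Y) {v : ℝ}
    (hv : ∀ e, ∫ ω, Y e ω ^ 2 ∂P = v) (i j : V) :
    ∫ ω, (symMatrix (fun e => Y e ω) ^ 2) i j ∂P = if i = j then Fintype.card V * v else 0 := by
  have hint (k : V) : Integrable (fun ω => Y s(i, k) ω * Y s(k, j) ω) P :=
    hY.integrable_comp (g := fun y => y s(i, k) * y s(k, j)) (by fun_prop)
  simp only [sq, Matrix.mul_apply, symMatrix_apply]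
  rw [integral_finsetSum _ fun k _ => hint k]
  split_ifs with h
  · subst h
    simp [Sym2.eq_swap (b := i), ← sq, hv]
  · refine Finset.sum_eq_zero fun k _ => ?_
    rw [(hY.indep.indepFun (by simp; grind)).integral_fun_mul_eq_mul_integral
      (hY.measurable _).aestronglyMeasurable (hY.measurable _).aestronglyMeasurable,
      hY.integral_eq_zero, zero_mul]

lemma integral_sum_symMatrix_sq (hY : IsCenteredNoise P K Y) {v : ℝ}
    (hv : ∀ e, ∫ ω, Y e ω ^ 2 ∂P = v) :
    ∫ ω, ∑ i, ∑ j, (symMatrix (fun e => Y e ω) ^ 2) i j ∂P = Fintype.card V ^ 2 * v := by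
  have hint (i j : V) : Integrable (fun ω => (symMatrix (fun e => Y e ω) ^ 2) i j) P :=
    hY.integrable_symMatrix (g := fun M => (M ^ 2) i j) (by fun_prop)
  rw [integral_finsetSum _ fun i _ => integrable_finsetSum _ fun j _ => hint i j]
  simp_rw [integral_finsetSum _ fun j _ => hint _ j, hY.integral_symMatrix_sq_apply hv]
  simp [sq, mul_assoc]

open Classical in
lemma abs_integral_sum_symMatrix_pow_le [Nonempty V] (hY : IsCenteredNoise P K Y) {m C d : ℕ}
    (hcard : (Finset.univ.filter fun q : Fin (m + 1) → V => IsRepeating (walkEdge q)).card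
      ≤ C * Fintype.card V ^ d) :
    |∫ ω, ∑ i, ∑ j, (symMatrix (fun e => Y e ω) ^ m) i j ∂P|
      ≤ C * Fintype.card V ^ d * K ^ m := by
  have hK := hY.nonneg s(Classical.arbitrary V, Classical.arbitrary V)
  simp only [sum_symMatrix_pow_eq_sum_walks]
  refine (hY.abs_integral_sum_prod_le fun q : Fin (m + 1) → V => walkEdge q).trans ?_
  rw [Fintype.card_fin]
  gcongr
  exact_mod_cast hcard

lemma abs_integral_sum_symMatrix_cube_le [Nonempty V] (hY : IsCenteredNoise P K Y) :
    |∫ ω, ∑ i, ∑ j, (symMatrix (fun e => Y e ω) ^ 3) i j ∂P| ≤ Fintype.card V ^ 2 * K ^ 3 := by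
  simpa using hY.abs_integral_sum_symMatrix_pow_le (C := 1)
    ((one_mul (Fintype.card V ^ 2)).symm ▸ card_isRepeating_walkEdge_three_le)

lemma integral_sum_symMatrix_pow_four_le [Nonempty V] (hY : IsCenteredNoise P K Y) :
    ∫ ω, ∑ i, ∑ j, (symMatrix (fun e => Y e ω) ^ 4) i j ∂P
      ≤ 2 * Fintype.card V ^ 3 * K ^ 4 := by
  exact_mod_cast (le_abs_self _).trans
    (hY.abs_integral_sum_symMatrix_pow_le card_isRepeating_walkEdge_four_le)

lemma integral_symMatrix_sq_apply_pow_four_le (hY : IsCenteredNoise P K Y) {i j : V}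
    (hij : i ≠ j) :
    ∫ ω, (symMatrix (fun e => Y e ω) ^ 2) i j ^ 4 ∂P ≤ 3 * Fintype.card V ^ 2 * K ^ 8 := by
  classical
  simp only [symMatrix_sq_apply_pow_eq_sum_paths]
  refine (le_abs_self _).trans ((hY.abs_integral_sum_prod_le
    fun q : Fin 4 → V => pathEdge i j q).trans ?_)
  rw [Fintype.card_prod, Fintype.card_fin, Fintype.card_bool]
  gcongr
  · exact Even.pow_nonneg (by decide) K
  · exact_mod_cast (Finset.card_le_card <| Finset.monotone_filter_right _
      fun _ _ => isRepeating_of_isRepeating_pathEdge hij).trans card_isRepeating_fin_four_le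

lemma integrable_offDiag_symMatrix_sq_pow_four (hY : IsCenteredNoise P K Y) (i j : V) :
    Integrable (fun ω => if i = j then 0 else (symMatrix (fun e => Y e ω) ^ 2) i j ^ 4) P :=
  hY.integrable_symMatrix (g := fun M => if i = j then 0 else (M ^ 2) i j ^ 4)
    (.if_const _ continuous_const (by fun_prop))

lemma integrable_sum_offDiag_symMatrix_sq_pow_four (hY : IsCenteredNoise P K Y) :
    Integrable (fun ω =>
      ∑ i, ∑ j, if i = j then 0 else (symMatrix (fun e => Y e ω) ^ 2) i j ^ 4) P :=
  integrable_finsetSum _ fun i _ => integrable_finsetSum _ fun j _ =>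
    hY.integrable_offDiag_symMatrix_sq_pow_four i j

lemma integral_sum_offDiag_symMatrix_sq_pow_four_le (hY : IsCenteredNoise P K Y) :
    ∫ ω, ∑ i, ∑ j, (if i = j then 0 else (symMatrix (fun e => Y e ω) ^ 2) i j ^ 4) ∂P
      ≤ 3 * Fintype.card V ^ 4 * K ^ 8 := by
  have hint := hY.integrable_offDiag_symMatrix_sq_pow_four
  rw [integral_finsetSum _ fun i _ => integrable_finsetSum _ fun j _ => hint i j]
  simp_rw [integral_finsetSum _ fun j _ => hint _ j]
  calc _ ≤ ∑ _i : V, ∑ _j : V, 3 * Fintype.card V ^ 2 * K ^ 8 := by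
        gcongr with i _ j _
        split_ifs with h
        · rw [integral_zero]
          positivity
        · exact hY.integral_symMatrix_sq_apply_pow_four_le h
    _ = 3 * Fintype.card V ^ 4 * K ^ 8 := by
        simp only [Finset.sum_const, Finset.card_univ, nsmul_eq_mul]
        ring

end IsCenteredNoise

end SymmetricMatrices

end Moments

section ExpectedPrincipalEigenvalue

variable {N : ℕ} {Ω : Type*} [MeasurableSpace Ω] {P : Measure Ω} {K μ v : ℝ}
  {Y : Sym2 (Fin N) → Ω → ℝ}

/-- A constant `C` for which the mean of the principal eigenvalue of a symmetric matrix of size `N`,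
with independent entries of mean `μ` and with fluctuations bounded by `K`, is within `C / N` of its
second order expansion, as soon as `128 * K ^ 2 ≤ μ ^ 2 * N`. -/
noncomputable def expansionConst (K μ : ℝ) : ℝ :=
  K ^ 3 / μ ^ 2 + 18 * (K ^ 2 / μ + K ^ 4 / μ ^ 3)
    + 3 * 2 ^ 28 * K ^ 9 * (2 + K / μ + K ^ 2 / μ ^ 2) / μ ^ 8

lemma expansionConst_le_of_le {δ : ℝ} (hK : 0 ≤ K) (hδ : 0 < δ) (h : δ ≤ μ) :
    expansionConst K μ ≤ expansionConst K δ := by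
  have := hδ.trans_le h
  unfold expansionConst
  gcongr

namespace IsCenteredNoise

lemma integrable_sum_symMatrix_pow (hY : IsCenteredNoise P K Y) (m : ℕ) :
    Integrable (fun ω => ∑ i, ∑ j, (symMatrix (fun e => Y e ω) ^ m) i j) P :=
  hY.integrable_symMatrix (g := fun M => ∑ i, ∑ j, (M ^ m) i j) (by fun_prop)

variable [NeZero N]

lemma integrable_principalEigenvalue (hY : IsCenteredNoise P K Y) :
    Integrable (fun ω => principalEigenvalue (symMatrix fun e => μ + Y e ω)) P :=
  hY.integrable_comp (g := fun y => principalEigenvalue (symMatrix fun e => μ + y e))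
    (continuous_principalEigenvalue_symMatrix.comp (by fun_prop))

lemma integral_principalEigenvalue_eq (hY : IsCenteredNoise P K Y)
    (hv : ∀ e, ∫ ω, Y e ω ^ 2 ∂P = v) :
    ∫ ω, principalEigenvalue (symMatrix fun e => μ + Y e ω) ∂P
      = N * μ + v / μ + (∫ ω, ∑ i, ∑ j, (symMatrix (fun e => Y e ω) ^ 3) i j ∂P) / N / (N * μ) ^ 2
        + ∫ ω, expansionError μ (symMatrix fun e => Y e ω) ∂P := by
  have := hY.isProbabilityMeasure
  have hl := hY.integrable_principalEigenvalue (μ := μ)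
  simp only [symMatrix_const_add] at hl ⊢
  have h1 := ((hY.integrable_symMatrix (g := fun M => ∑ i, ∑ j, M i j) (by fun_prop)).div_const
    (N : ℝ))
  have h2 := ((hY.integrable_sum_symMatrix_pow 2).div_const (N : ℝ)).div_const (N * μ)
  have h3 := ((hY.integrable_sum_symMatrix_pow 3).div_const (N : ℝ)).div_const ((N * μ) ^ 2)
  have hN : (N : ℝ) ≠ 0 := Nat.cast_ne_zero.2 (NeZero.ne N)
  have hvar : N ^ 2 * v / N / (N * μ) = v / μ := by field_simp
  unfold expansionError
  have h01 := (hl.sub' (integrable_const (N * μ))).sub' h1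
  rw [integral_sub (h01.sub' h2) h3, integral_sub h01 h2,
    integral_sub (hl.sub' (integrable_const _)) h1, integral_sub hl (integrable_const _)]
  simp only [integral_div, hY.integral_sum_symMatrix, hY.integral_sum_symMatrix_sq hv,
    integral_const, probReal_univ, Fintype.card_fin, hvar]
  rw [one_smul]
  ring

lemma abs_integral_expansionError_le (hY : IsCenteredNoise P K Y) (hμ : 0 < μ)
    (hN : 128 * K ^ 2 ≤ μ ^ 2 * N) :
    |∫ ω, expansionError μ (symMatrix fun e => Y e ω) ∂P|
      ≤ (18 * (K ^ 2 / μ + K ^ 4 / μ ^ 3)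
        + 3 * 2 ^ 28 * K ^ 9 * (2 + K / μ + K ^ 2 / μ ^ 2) / μ ^ 8) / N := by
  have hN0 : (N : ℝ) ≠ 0 := Nat.cast_ne_zero.2 (NeZero.ne N)
  have hK := hY.nonneg s(0, 0)
  have hS1 : Integrable (fun ω =>
      ((∑ i, ∑ j, symMatrix (fun e => Y e ω) i j) / N) ^ 2 / (N * μ)) P :=
    hY.integrable_symMatrix (g := fun M => ((∑ i, ∑ j, M i j) / N) ^ 2 / (N * μ)) (by fun_prop)
  have hS4 := ((hY.integrable_sum_symMatrix_pow 4).div_const (N : ℝ)).div_const ((N * μ) ^ 3)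
  have hS := hS1.fun_add hS4
  have hR := hY.integrable_sum_offDiag_symMatrix_sq_pow_four
  have hint := norm_integral_le_of_norm_le (f := fun ω => expansionError μ (symMatrix (Y · ω)))
    ((hS.const_mul 9).fun_add (hR.const_mul _)) <| ae_of_all P fun ω =>
      abs_expansionError_le_of_abs_le (isSymm_symMatrix (Y · ω)) hμ hK
        (fun i j => hY.abs_le s(i, j) ω) hN
  rw [integral_add (hS.const_mul 9) (hR.const_mul _), integral_const_mul,
    integral_const_mul, integral_add hS1 hS4] at hint
  simp only [div_pow, integral_div] at hint
  have h1 := hY.integral_sq_sum_symMatrix_le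
  have h4 := hY.integral_sum_symMatrix_pow_four_le
  have hR4 := hY.integral_sum_offDiag_symMatrix_sq_pow_four_le
  rw [Fintype.card_fin] at h1 h4 hR4
  calc _ ≤ _ := hint
    _ ≤ 9 * (2 * N ^ 2 * K ^ 2 / N ^ 2 / (N * μ) + 2 * N ^ 3 * K ^ 4 / N / (N * μ) ^ 3)
        + K * (2 + K / μ + K ^ 2 / μ ^ 2) * 2 ^ 28 / (μ ^ 8 * N ^ 5) * (3 * N ^ 4 * K ^ 8) := by
      gcongr
    _ = _ := by
      field_simp
      ring

theorem abs_integral_principalEigenvalue_sub_le (hY : IsCenteredNoise P K Y) (hμ : 0 < μ)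
    (hN : 128 * K ^ 2 ≤ μ ^ 2 * N) (hv : ∀ e, ∫ ω, Y e ω ^ 2 ∂P = v) :
    |∫ ω, principalEigenvalue (symMatrix fun e => μ + Y e ω) ∂P - (N * μ + v / μ)|
      ≤ expansionConst K μ / N := by
  have hN0 : (N : ℝ) ≠ 0 := Nat.cast_ne_zero.2 (NeZero.ne N)
  have hcube : |(∫ ω, ∑ i, ∑ j, (symMatrix (fun e => Y e ω) ^ 3) i j ∂P) / N / (N * μ) ^ 2|
      ≤ K ^ 3 / μ ^ 2 / N := by
    have h := hY.abs_integral_sum_symMatrix_cube_le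
    rw [Fintype.card_fin] at h
    rw [abs_div, abs_div, Nat.abs_cast, abs_of_nonneg (sq_nonneg (N * μ : ℝ))]
    calc _ ≤ N ^ 2 * K ^ 3 / N / (N * μ) ^ 2 := by gcongr
      _ = _ := by field_simp
  rw [hY.integral_principalEigenvalue_eq hv, add_assoc, add_sub_cancel_left]
  calc _ ≤ _ := abs_add_le _ _
    _ ≤ _ := add_le_add hcube (hY.abs_integral_expansionError_le hμ hN)
    _ = expansionConst K μ / N := by
      unfold expansionConst
      ring

end IsCenteredNoise

end ExpectedPrincipalEigenvalue

section Bernoulli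

variable {ι Ω : Type*} [MeasurableSpace Ω] {P : Measure Ω} {p : ℝ}

/-- A family of independent Bernoulli random variables with success probability `p`, with values
in `{0, 1}` viewed as a subset of `ℝ`. -/
structure IsBernoulliFamily (P : Measure Ω) (p : ℝ) (b : ι → Ω → ℝ) : Prop where
  measurable : ∀ e, Measurable (b e)
  eq_zero_or_one : ∀ e ω, b e ω = 0 ∨ b e ω = 1
  indep : iIndepFun b P
  measureReal_eq : ∀ e, P.real {ω | b e ω = 1} = p

namespace IsBernoulliFamily

variable {b : ι → Ω → ℝ}

lemma integrable (hb : IsBernoulliFamily P p b) (e : ι) : Integrable (b e) P := by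
  have := hb.indep.isProbabilityMeasure
  refine .of_bound (hb.measurable e).aestronglyMeasurable 1 (ae_of_all _ fun ω => ?_)
  rcases hb.eq_zero_or_one e ω with h | h <;> simp [h]

lemma integral_eq (hb : IsBernoulliFamily P p b) (e : ι) : ∫ ω, b e ω ∂P = p := by
  have hind : b e = {ω | b e ω = 1}.indicator 1 := by
    ext ω
    rcases hb.eq_zero_or_one e ω with h | h <;> simp [Set.indicator, h]
  have hmeas : MeasurableSet {ω | b e ω = 1} := hb.measurable e (measurableSet_singleton 1)
  calc ∫ ω, b e ω ∂P = ∫ ω, {ω | b e ω = 1}.indicator 1 ω ∂P := by rw [← hind]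
    _ = P.real {ω | b e ω = 1} := integral_indicator_one hmeas
    _ = p := hb.measureReal_eq e

lemma mem_Icc (hb : IsBernoulliFamily P p b) (e : ι) : p ∈ Set.Icc 0 1 := by
  have := hb.indep.isProbabilityMeasure
  exact hb.measureReal_eq e ▸ ⟨measureReal_nonneg, measureReal_le_one⟩

lemma isCenteredNoise_sub (hb : IsBernoulliFamily P p b) :
    IsCenteredNoise P 1 fun e ω => b e ω - p where
  measurable e := (hb.measurable e).sub_const p
  abs_le e ω := by
    obtain ⟨hp0, hp1⟩ := hb.mem_Icc e
    rcases hb.eq_zero_or_one e ω with h | h <;> rw [h, abs_le] <;> constructor <;> linarith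
  indep := hb.indep.comp (fun _ x => x - p) fun _ => measurable_id.sub_const p
  integral_eq_zero e := by
    have := hb.indep.isProbabilityMeasure
    rw [integral_sub (hb.integrable e) (integrable_const p), hb.integral_eq, integral_const,
      probReal_univ, one_smul, sub_self]

lemma integral_sub_sq (hb : IsBernoulliFamily P p b) (e : ι) :
    ∫ ω, (b e ω - p) ^ 2 ∂P = p * (1 - p) := by
  have := hb.indep.isProbabilityMeasure
  have hsq (ω : Ω) : (b e ω - p) ^ 2 = (1 - 2 * p) * b e ω + p ^ 2 := by
    rcases hb.eq_zero_or_one e ω with h | h <;> rw [h] <;> ring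
  simp_rw [hsq]
  rw [integral_add ((hb.integrable e).const_mul _) (integrable_const _), integral_const_mul,
    hb.integral_eq, integral_const, probReal_univ, one_smul]
  ring

variable {N : ℕ} [NeZero N] {b : Sym2 (Fin N) → Ω → ℝ}

lemma integrable_principalEigenvalue (hb : IsBernoulliFamily P p b) :
    Integrable (fun ω => principalEigenvalue (symMatrix (b · ω))) P := by
  simpa only [add_sub_cancel] using
    hb.isCenteredNoise_sub.integrable_principalEigenvalue (μ := p)

theorem abs_integral_principalEigenvalue_sub_le (hb : IsBernoulliFamily P p b) {δ : ℝ}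
    (hδ : 0 < δ) (hδp : δ ≤ p) (hN : 128 ≤ δ ^ 2 * N) :
    |∫ ω, principalEigenvalue (symMatrix (b · ω)) ∂P - (N * p + (1 - p))|
      ≤ expansionConst 1 δ / N := by
  have hp := hδ.trans_le hδp
  have hNp : 128 * 1 ^ 2 ≤ p ^ 2 * N := by
    rw [one_pow, mul_one]
    exact hN.trans (by gcongr)
  have h := hb.isCenteredNoise_sub.abs_integral_principalEigenvalue_sub_le hp hNp hb.integral_sub_sq
  simp only [add_sub_cancel] at h
  rw [mul_div_cancel_left₀ _ hp.ne'] at h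
  refine h.trans ?_
  gcongr
  exact expansionConst_le_of_le zero_le_one hδ hδp

end IsBernoulliFamily

end Bernoulli

section Model

variable {N : ℕ}

/-- The label in the `N`-vertex model of a label of the single edge of the one-vertex model, when
that edge is identified with `e`. -/
def relabel (e : Sym2 (Fin N)) : Source 1 → Source N
  | .init _ => .init e
  | .off _ l => .off e l
  | .on _ l => .on e l

lemma relabel_injective2 : Function.Injective2 (relabel (N := N)) := by
  rintro e e' (s | ⟨s, k⟩ | ⟨s, k⟩) (s' | ⟨s', k'⟩ | ⟨s', k'⟩) h <;>
    simp_all [relabel, Subsingleton.elim s s']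

lemma sourceLaw_relabel (p₀ lamOn lamOff : ℝ) (e : Sym2 (Fin N)) (s : Source 1) :
    sourceLaw p₀ lamOn lamOff (relabel e s) = sourceLaw p₀ lamOn lamOff s := by
  cases s <;> rfl

lemma adjacency_eq_symMatrix (x : Source N → ℝ) (t : ℝ) :
    adjacency x t = symMatrix (edgeState x · t) := rfl

lemma edgeState_eq_zero_or_one (x : Source N → ℝ) (e : Sym2 (Fin N)) (t : ℝ) :
    edgeState x e t = 0 ∨ edgeState x e t = 1 := by
  unfold edgeState
  split_ifs <;> simp

lemma measurableSet_exists_mem_Ico_cycleTime (e : Sym2 (Fin N)) (t : ℝ) (f : ℕ → Source N) :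
    MeasurableSet {x : Source N → ℝ |
      ∃ k, t ∈ Set.Ico (cycleTime x e k) (cycleTime x e k + x (f k))} := by
  have hcycle (k : ℕ) : Measurable fun x : Source N → ℝ => cycleTime x e k := by
    unfold cycleTime
    fun_prop
  simp only [Set.ofPred_exists]
  exact .iUnion fun k => (measurableSet_le (hcycle k) measurable_const).inter
    (measurableSet_lt measurable_const ((hcycle k).add (measurable_pi_apply _)))

lemma measurable_edgeState (e : Sym2 (Fin N)) (t : ℝ) :
    Measurable fun x : Source N → ℝ => edgeState x e t :=
  .ite (measurableSet_eq_fun (measurable_pi_apply _) measurable_const)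
    (.ite (measurableSet_exists_mem_Ico_cycleTime e t _) measurable_const measurable_const)
    (.ite (measurableSet_exists_mem_Ico_cycleTime e t _) measurable_const measurable_const)

/-- The probability that a given edge is present at time `t`, computed in the model with one
vertex. -/
noncomputable def edgeProb (p₀ lamOn lamOff t : ℝ) : ℝ :=
  (Measure.infinitePi (sourceLaw (N := 1) p₀ lamOn lamOff)).real {x | edgeState x s(0, 0) t = 1}

lemma iIndepFun_curry {ι κ Ω β : Type*} [MeasurableSpace Ω] [MeasurableSpace β] {P : Measure Ω}
    {X : ι → κ → Ω → β} (hm : ∀ i k, Measurable (X i k))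
    (h : iIndepFun (fun q : ι × κ => X q.1 q.2) P) : iIndepFun (fun i ω k => X i k ω) P := by
  have := h.isProbabilityMeasure
  have hprob (i : ι) (k : κ) : IsProbabilityMeasure (P.map (X i k)) :=
    Measure.isProbabilityMeasure_map (hm i k).aemeasurable
  have hrow (i : ι) : P.map (fun ω k => X i k ω) = Measure.infinitePi fun k => P.map (X i k) :=
    (h.precomp (Prod.mk_right_injective i)).map_fun_eq_infinitePi_map (hm i)
  have hjoint : P.map (fun ω (q : ι × κ) => X q.1 q.2 ω)
      = Measure.infinitePi fun q : ι × κ => P.map (X q.1 q.2) :=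
    h.map_fun_eq_infinitePi_map fun q => hm q.1 q.2
  rw [iIndepFun_iff_map_fun_eq_infinitePi_map fun i => measurable_pi_lambda _ (hm i)]
  simp_rw [hrow]
  rw [← Measure.infinitePi_map_curry fun i k => P.map (X i k), ← hjoint,
    Measure.map_map (MeasurableEquiv.measurable _) (measurable_pi_lambda _ fun _ => hm _ _)]
  rfl

lemma measureReal_expMeasure_Ioi {r T : ℝ} (hr : 0 < r) (hT : 0 ≤ T) :
    (expMeasure r).real (Set.Ioi T) = Real.exp (-(r * T)) := by
  have := isProbabilityMeasure_expMeasure hr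
  rw [← Set.compl_Iic, probReal_compl_eq_one_sub measurableSet_Iic, ← cdf_eq_real,
    cdf_expMeasure_eq hr, if_pos hT, sub_sub_cancel]

namespace IsDriving

variable {Ω : Type*} [MeasurableSpace Ω] {P : Measure Ω} {p₀ lamOn lamOff : ℝ}
  {X : Source N → Ω → ℝ}

lemma measureReal_edgeState_eq_one (hX : IsDriving p₀ lamOn lamOff P X) (e : Sym2 (Fin N))
    (t : ℝ) : P.real {ω | edgeState (X · ω) e t = 1} = edgeProb p₀ lamOn lamOff t := by
  have hlaw : HasLaw (fun ω s => X (relabel e s) ω)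
      (Measure.infinitePi (sourceLaw (N := 1) p₀ lamOn lamOff)) P :=
    (hX.indep.precomp (relabel_injective2.right e)).hasLaw_infinitePi
      (fun s => sourceLaw_relabel p₀ lamOn lamOff e s ▸ hX.hasLaw (relabel e s))
      (measurable_pi_lambda _ fun s => hX.measurable _).aemeasurable
  exact hlaw.measureReal_eq (measurable_edgeState s(0, 0) t (measurableSet_singleton 1))

lemma iIndepFun_edgeState (hX : IsDriving p₀ lamOn lamOff P X) (t : ℝ) :
    iIndepFun (fun e ω => edgeState (X · ω) e t) P :=
  (iIndepFun_curry (fun e s => hX.measurable (relabel e s))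
    (hX.indep.precomp relabel_injective2.uncurry)).comp
      (fun _ x => edgeState x s(0, 0) t) fun _ => measurable_edgeState _ t

lemma isBernoulliFamily_edgeState (hX : IsDriving p₀ lamOn lamOff P X) (t : ℝ) :
    IsBernoulliFamily P (edgeProb p₀ lamOn lamOff t) fun e ω => edgeState (X · ω) e t where
  measurable e := (measurable_edgeState e t).comp (measurable_pi_lambda _ hX.measurable)
  eq_zero_or_one e ω := edgeState_eq_zero_or_one (X · ω) e t
  indep := hX.iIndepFun_edgeState t
  measureReal_eq e := hX.measureReal_edgeState_eq_one e t

lemma measureReal_init_eq_one (hX : IsDriving p₀ lamOn lamOff P X) (hp₀ : 0 ≤ p₀)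
    (e : Sym2 (Fin N)) : P.real (X (.init e) ⁻¹' {1}) = p₀ := by
  rw [← map_measureReal_apply (hX.measurable _) (measurableSet_singleton 1),
    (hX.hasLaw _).map_eq]
  simp [sourceLaw, measureReal_def, hp₀]

lemma measureReal_lt_on (hX : IsDriving p₀ lamOn lamOff P X) (hOn : 0 < lamOn) {T : ℝ}
    (hT : 0 ≤ T) (e : Sym2 (Fin N)) (l : ℕ) :
    P.real (X (.on e l) ⁻¹' Set.Ioi T) = Real.exp (-(lamOn * T)) := by
  rw [← map_measureReal_apply (hX.measurable _) measurableSet_Ioi, (hX.hasLaw _).map_eq]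
  exact measureReal_expMeasure_Ioi hOn hT

lemma mul_exp_le_edgeProb (hX : IsDriving p₀ lamOn lamOff P X) (hp₀ : 0 ≤ p₀) (hOn : 0 < lamOn)
    (e : Sym2 (Fin N)) {T t : ℝ} (ht : t ∈ Set.Icc 0 T) :
    p₀ * Real.exp (-(lamOn * T)) ≤ edgeProb p₀ lamOn lamOff t := by
  have := hX.indep.isProbabilityMeasure
  have hind : IndepFun (X (.init e)) (X (.on e 0)) P := hX.indep.indepFun (by simp)
  rw [← hX.measureReal_edgeState_eq_one e t, ← hX.measureReal_init_eq_one hp₀ e,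
    ← hX.measureReal_lt_on hOn (ht.1.trans ht.2) e 0, measureReal_def, measureReal_def,
    ← ENNReal.toReal_mul, ← hind.measure_inter_preimage_eq_mul _ _ (measurableSet_singleton 1)
      measurableSet_Ioi]
  refine measureReal_mono ?_
  rintro ω ⟨hinit : X (.init e) ω = 1, hon : T < X (.on e 0) ω⟩
  have hmem : t ∈ Set.Ico (cycleTime (X · ω) e 0) (cycleTime (X · ω) e 0 + X (.on e 0) ω) := by
    simpa [cycleTime] using ⟨ht.1, ht.2.trans_lt hon⟩
  rw [Set.mem_ofPred_eq, edgeState, hinit, if_neg one_ne_zero, if_pos ⟨0, hmem⟩]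

lemma integrable_principalEigenvalue_adjacency [NeZero N] (hX : IsDriving p₀ lamOn lamOff P X)
    (t : ℝ) : Integrable (fun ω => principalEigenvalue (adjacency (X · ω) t)) P := by
  simp_rw [adjacency_eq_symMatrix]
  exact (hX.isBernoulliFamily_edgeState t).integrable_principalEigenvalue

theorem abs_integral_principalEigenvalue_adjacency_sub_le [NeZero N]
    (hX : IsDriving p₀ lamOn lamOff P X) (hp₀ : 0 < p₀) (hOn : 0 < lamOn) {T t : ℝ}
    (ht : t ∈ Set.Icc 0 T) (hN : 128 ≤ (p₀ * Real.exp (-(lamOn * T))) ^ 2 * N) :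
    |∫ ω, principalEigenvalue (adjacency (X · ω) t) ∂P
        - (N * edgeProb p₀ lamOn lamOff t + (1 - edgeProb p₀ lamOn lamOff t))|
      ≤ expansionConst 1 (p₀ * Real.exp (-(lamOn * T))) / N := by
  simp_rw [adjacency_eq_symMatrix]
  exact (hX.isBernoulliFamily_edgeState t).abs_integral_principalEigenvalue_sub_le (by positivity)
    (hX.mul_exp_le_edgeProb hp₀.le hOn s(0, 0) ht) hN

end IsDriving

end Model

end DynamicER

theorem theorem3p3 (p₀ lamOn lamOff T : ℝ) (hp₀ : 0 < p₀) (hp₁ : p₀ < 1)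
    (hOn : 0 < lamOn) (hOff : 0 < lamOff) (hT : 0 < T)
    {Ω : ℕ → Type*} [∀ N, MeasurableSpace (Ω N)]
    (P : ∀ N, Measure (Ω N)) [∀ N, IsProbabilityMeasure (P N)]
    (X : ∀ N, DynamicER.Source N → Ω N → ℝ)
    (hX : ∀ N, DynamicER.IsDriving p₀ lamOn lamOff (P N) (X N)) :
    ∃ p : ℝ → ℝ,
      (∀ N : ℕ, ∀ i j : Fin N, ∀ t ∈ Set.Icc 0 T,
        (P N).real {ω | DynamicER.adjacency (fun s => X N s ω) t i j = 1} = p t) ∧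
      ∃ G : ℕ → ℝ → ℝ,
        (∀ N : ℕ, 1 ≤ N → ∀ t ∈ Set.Icc 0 T,
          Integrable
            (fun ω => DynamicER.principalEigenvalue (DynamicER.adjacency (fun s => X N s ω) t))
            (P N) ∧
          ∫ ω, DynamicER.principalEigenvalue (DynamicER.adjacency (fun s => X N s ω) t) ∂(P N)
            = N * p t + (1 - p t) + G N t / N) ∧
        limsup (fun N : ℕ => ⨆ t ∈ Set.Icc 0 T, ENNReal.ofReal |G N t|) atTop < ⊤ := by
  set δ := p₀ * Real.exp (-(lamOn * T))
  set p := DynamicER.edgeProb p₀ lamOn lamOff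
  let mean (N : ℕ) (t : ℝ) : ℝ :=
    ∫ ω, DynamicER.principalEigenvalue (DynamicER.adjacency (X N · ω) t) ∂(P N)
  have hδ : 0 < δ := by positivity
  refine ⟨p, fun N i j t _ => (hX N).measureReal_edgeState_eq_one s(i, j) t,
    fun N t => N * (mean N t - (N * p t + (1 - p t))), fun N hN t _ => ?_, ?_⟩
  · have : NeZero N := ⟨by omega⟩
    refine ⟨(hX N).integrable_principalEigenvalue_adjacency t, ?_⟩
    rw [mul_div_cancel_left₀ _ (NeZero.ne (N : ℝ)), add_sub_cancel]
  refine (limsup_le_of_le (a := ENNReal.ofReal (DynamicER.expansionConst 1 δ)) (h := ?_)).trans_lt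
    ENNReal.ofReal_lt_top
  have hlarge : ∀ᶠ N : ℕ in atTop, 128 ≤ δ ^ 2 * N :=
    (tendsto_natCast_atTop_atTop.const_mul_atTop (pow_pos hδ 2)).eventually_ge_atTop 128
  filter_upwards [hlarge, eventually_ge_atTop 1] with N hN hN1
  have : NeZero N := ⟨by omega⟩
  refine iSup₂_le fun t ht => ENNReal.ofReal_le_ofReal ?_
  rw [abs_mul, Nat.abs_cast, ← le_div_iff₀' (Nat.cast_pos.2 hN1)]
  exact (hX N).abs_integral_principalEigenvalue_adjacency_sub_le hp₀ hOn ht hN
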